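/- For a finite tree $T$ let $\varphi(T)$ be the number of subtrees of $T$, that is, of (nonempty) subgraphs of $T$ that are trees; a leaf is a vertex of degree $1$. Let $n$ and $s\ge 2$ be integers such that $s\le n-1$ or $n=s=2$ (equivalently, for $s \ge 2$, such that there is a tree of order $n$ with $s$ leaves), and write $n-1=sq+t$ with integers $q\ge 0$ and $0\le t<s$. Let $T_s^*$ be the "spider" obtained from $t$ paths of order $q+2$ and $s-t$ paths of order $q+1$ by identifying one end of all $s$ paths. Then $T_s^*$ is a tree of order $n$ with $s$ leaves, and it is, up to isomorphism, the only tree with the largest number of subtrees among all trees of order $n$ with $s$ leaves: every such tree $T$ satisfies $\varphi(T)\le\varphi(T_s^*)$, with equality if and only if $T$ is isomorphic to $T_s^*$. Moreover $$\varphi(T_s^*)=(q+2)^t(q+1)^{s-t}+t\binom{q+2}{2}+(s-t)\binom{q+1}{2}.$$ In other words, for every tree $T$ of order $n$ with $s$ leaves, $$\varphi(T)\le (q+2)^t(q+1)^{s-t}+t\binom{q+2}{2}+(s-t)\binom{q+1}{2},$$ with equality if and only if $T$ is isomorphic to $T_s^*$. -/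

import Mathlib

/-- The number `φ(G)` of subtrees of a graph: subgraphs (a set of vertices together with a set of
edges between them) which are trees.  A tree is nonempty, so the empty subgraph is not counted,
while every single vertex is. -/
noncomputable def numSubtrees {V : Type*} (G : SimpleGraph V) : ℕ :=
  {H : G.Subgraph | H.coe.IsTree}.ncard

/-- The number of leaves of a graph, that is, of vertices of degree one. -/
noncomputable def numLeaves {V : Type*} (G : SimpleGraph V) : ℕ :=
  {v : V | (G.neighborSet v).ncard = 1}.ncard

/-- `G` is a tree of order `n` with `s` leaves. -/
structure IsTreeWithLeaves {V : Type*} (G : SimpleGraph V) (n s : ℕ) : Prop where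
  isTree : G.IsTree
  order : Nat.card V = n
  leaves : numLeaves G = s

/-- The vertices obtained from `s` paths, the `i`-th of which has order `len i + 1`, by identifying
one end of all of them: `none` is the common end, `some ⟨i, k⟩` is the vertex of the `i`-th path at
distance `k + 1` from that end. -/
abbrev GluedPathsVertex {s : ℕ} (len : Fin s → ℕ) : Type :=
  Option (Σ i : Fin s, Fin (len i))

/-- The map which sends the vertices `0, 1, …, len i` of the `i`-th path to vertices of the glued
graph; the end `0` goes to the common vertex. -/
def gluedPathsMap {s : ℕ} (len : Fin s → ℕ) (i : Fin s) :
    Fin (len i + 1) → GluedPathsVertex len :=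
  Fin.cases none (fun k => some ⟨i, k⟩)

theorem gluedPathsMap_injective {s : ℕ} (len : Fin s → ℕ) (i : Fin s) :
    Function.Injective (gluedPathsMap len i) := by
  intro a b
  refine Fin.cases ?_ (fun a => ?_) a <;> refine Fin.cases ?_ (fun b => ?_) b <;>
    simp [gluedPathsMap]

/-- The graph obtained from `s` paths, the `i`-th of order `len i + 1`, by identifying one end of
all of them. -/
def gluedPaths {s : ℕ} (len : Fin s → ℕ) : SimpleGraph (GluedPathsVertex len) where
  Adj u v := ∃ (i : Fin s) (a b : Fin (len i + 1)), (SimpleGraph.pathGraph (len i + 1)).Adj a b ∧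
    gluedPathsMap len i a = u ∧ gluedPathsMap len i b = v
  symm := ⟨fun _ _ ⟨i, a, b, hab, ha, hb⟩ => ⟨i, b, a, hab.symm, hb, ha⟩⟩
  loopless := ⟨fun _ ⟨i, _, _, hab, ha, hb⟩ =>
    hab.ne (gluedPathsMap_injective len i (ha.trans hb.symm))⟩

/-- The numbers of edges of the legs of the spider: `q + 1` for the first `t` legs (paths of
order `q + 2`) and `q` for the other ones (paths of order `q + 1`). -/
def spiderLeg (s q t : ℕ) (i : Fin s) : ℕ :=
  if (i : ℕ) < t then q + 1 else q

/-- The spider `T*_s`: `t` paths of order `q + 2` and `s - t` paths of order `q + 1`, glued at a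
common end. -/
abbrev spider (s q t : ℕ) : SimpleGraph (GluedPathsVertex (spiderLeg s q t)) :=
  gluedPaths (spiderLeg s q t)

/-! In a forest a subtree is determined by its vertex set, so φ counts the vertex sets that induce
connected subgraphs.

Suppose a tree has two vertices u, v of degree at least 3, where the connected sets through u
avoiding v are at least as many as those through v avoiding u. Detach from v a branch that does not
lead to u and hang it on u. The number of leaves stays the same. Joining two components by an edge
adds the product of the numbers of connected sets at its two ends (`ncard_connSets_sup_edge`), and
after the cut u lies in more connected sets than v, so φ grows (`exists_moved_branch`).

Hence a maximiser has at most one branching vertex and consists of s paths glued at an end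
(`exists_iso_gluedPaths`). There φ is the product of all `len i + 1`, for the sets through the
centre, plus the sum of the `(len i + 1).choose 2`, for the intervals inside a leg
(`numSubtrees_gluedPaths`). If s ≥ 3, evening out two legs whose lengths differ by at least two
increases this number (`exists_legCount_lt`), so the legs of a maximiser are those of the spider. If
s = 2, every tree in question is the path of order n. -/

/-! ### Subtrees as connected vertex sets. -/

/-- A set of vertices induces a connected graph iff it is nonempty and every property which
propagates along the edges inside it is constant on it. -/
theorem connected_induce_iff {V : Type*} {G : SimpleGraph V} {S : Set V} :
    (G.induce S).Connected ↔ S.Nonempty ∧ ∀ P : V → Prop,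
      (∀ u ∈ S, ∀ v ∈ S, G.Adj u v → P u → P v) → ∀ u ∈ S, ∀ v ∈ S, P u → P v := by
  constructor
  · intro h
    refine ⟨Set.nonempty_coe_sort.mp h.nonempty, fun P hP u hu v hv hPu => ?_⟩
    obtain ⟨w⟩ := h.preconnected ⟨u, hu⟩ ⟨v, hv⟩
    have key : ∀ a b : S, (G.induce S).Walk a b → P a → P b := by
      intro a b w
      induction w with
      | nil => exact id
      | cons hab _ ih => exact fun ha => ih (hP _ (Subtype.coe_prop _) _ (Subtype.coe_prop _) hab ha)
    exact key _ _ w hPu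
  · rintro ⟨hne, h⟩
    have := hne.to_subtype
    refine ⟨fun ⟨u, hu⟩ ⟨v, hv⟩ => ?_⟩
    obtain ⟨_, hr⟩ := h (fun w => ∃ hw : w ∈ S, (G.induce S).Reachable ⟨u, hu⟩ ⟨w, hw⟩)
      (fun a _ b hb hab ⟨_, hr⟩ => ⟨hb, hr.trans (SimpleGraph.Adj.reachable (by simpa using hab))⟩)
      u hu v hv ⟨hu, SimpleGraph.Reachable.refl _⟩
    exact hr

/-- The vertex sets of connected induced subgraphs. -/
def connSets {V : Type*} (G : SimpleGraph V) : Set (Set V) :=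
  {S | (G.induce S).Connected}

/-- The number of connected vertex sets containing a given vertex. -/
noncomputable def numConnAt {V : Type*} (G : SimpleGraph V) (v : V) : ℕ :=
  {S | S ∈ connSets G ∧ v ∈ S}.ncard

/-- A tree is a minimal connected graph on its vertices. The subgraph induced on the vertices of a
subtree is again a tree, so the subtree already has all its edges. -/
theorem numSubtrees_eq_ncard_connSets {V : Type*} {G : SimpleGraph V} (hG : G.IsAcyclic) :
    numSubtrees G = (connSets G).ncard := by
  have adj_of : ∀ H : G.Subgraph, H.coe.IsTree → ∀ u ∈ H.verts, ∀ v ∈ H.verts,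
      G.Adj u v → H.Adj u v := by
    intro H hH u hu v hv huv
    have hle : H.coe ≤ G.induce H.verts := fun a b hab => H.adj_sub hab
    have htree : (G.induce H.verts).IsTree := ⟨hH.connected.mono hle, hG.induce _⟩
    have := (SimpleGraph.isTree_iff_minimal_connected.mp htree).2 hH.connected hle
    exact this (show (G.induce H.verts).Adj ⟨u, hu⟩ ⟨v, hv⟩ from huv)
  have hinj : Set.InjOn SimpleGraph.Subgraph.verts {H : G.Subgraph | H.coe.IsTree} := by
    intro H hH K hK hHK
    refine SimpleGraph.Subgraph.ext hHK ?_
    ext u v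
    constructor
    · intro h
      exact adj_of K hK u (hHK ▸ h.fst_mem) v (hHK ▸ h.snd_mem) h.adj_sub
    · intro h
      exact adj_of H hH u (hHK ▸ h.fst_mem) v (hHK ▸ h.snd_mem) h.adj_sub
  rw [numSubtrees, ← hinj.ncard_image]
  congr 1
  ext S
  constructor
  · rintro ⟨H, hH, rfl⟩
    exact SimpleGraph.Connected.mono (fun a b hab => H.adj_sub hab) hH.connected
  · intro hS
    refine ⟨(⊤ : G.Subgraph).induce S, ?_, rfl⟩
    have h : (G.induce S).IsTree := ⟨hS, hG.induce S⟩
    rw [SimpleGraph.induce_eq_coe_induce_top] at h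
    exact h

theorem image_mem_connSets {V W : Type*} {G : SimpleGraph V} {G' : SimpleGraph W} (e : G ≃g G')
    {S : Set V} (hS : S ∈ connSets G) : e '' S ∈ connSets G' := by
  obtain ⟨hne, h⟩ := connected_induce_iff.mp hS
  refine connected_induce_iff.mpr ⟨hne.image _, ?_⟩
  rintro P hP _ ⟨u, hu, rfl⟩ _ ⟨v, hv, rfl⟩
  exact h (fun w => P (e w)) (fun a ha b hb hab => hP _ ⟨a, ha, rfl⟩ _ ⟨b, hb, rfl⟩
    (e.map_adj_iff.mpr hab)) u hu v hv

theorem numSubtrees_congr {V W : Type*} {G : SimpleGraph V} {G' : SimpleGraph W} (e : G ≃g G')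
    (hG : G.IsTree) : numSubtrees G = numSubtrees G' := by
  rw [numSubtrees_eq_ncard_connSets hG.isAcyclic,
    numSubtrees_eq_ncard_connSets (e.isTree_iff.mp hG).isAcyclic,
    ← Set.ncard_image_of_injective _ e.injective.image_injective]
  congr 1
  ext S
  constructor
  · rintro ⟨S, hS, rfl⟩
    exact image_mem_connSets e hS
  · intro hS
    refine ⟨e.symm '' S, image_mem_connSets e.symm hS, ?_⟩
    rw [Set.image_image]
    simp

/-! ### Adding an edge between two components. -/

/-- Cutting a connected set along the only edge that leaves `X`. -/
theorem inter_mem_connSets {V : Type*} {H : SimpleGraph V} {x y : V} {X S : Set V}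
    (hX : ∀ a b, H.Adj a b → (a ∈ X ↔ b ∈ X)) (hx : x ∈ X) (hy : y ∉ X)
    (hS : S ∈ connSets (H ⊔ SimpleGraph.edge y x)) (hxS : x ∈ S) : S ∩ X ∈ connSets H := by
  obtain ⟨-, h⟩ := connected_induce_iff.mp hS
  refine connected_induce_iff.mpr ⟨⟨x, hxS, hx⟩, fun P hP u hu v hv hPu => ?_⟩
  -- The extra edge meets `X` only at `x`. If `P x` holds, `P` is extended by true outside `X`,
  -- otherwise by false; either way the extension propagates along that edge.
  by_cases hPx : P x
  · refine h (fun w => w ∈ X → P w) ?_ u hu.1 v hv.1 (fun _ => hPu) hv.2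
    intro a ha b hb hab hPa hbX
    simp only [SimpleGraph.sup_adj, SimpleGraph.edge_adj] at hab
    rcases hab with hab | ⟨⟨rfl, rfl⟩ | ⟨rfl, rfl⟩, -⟩
    · have haX := (hX a b hab).mpr hbX
      exact hP a ⟨ha, haX⟩ b ⟨hb, hbX⟩ hab (hPa haX)
    · exact hPx
    · exact absurd hbX hy
  · refine (h (fun w => w ∈ X ∧ P w) ?_ u hu.1 v hv.1 ⟨hu.2, hPu⟩).2
    rintro a ha b hb hab ⟨haX, hPa⟩
    simp only [SimpleGraph.sup_adj, SimpleGraph.edge_adj] at hab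
    rcases hab with hab | ⟨⟨rfl, rfl⟩ | ⟨rfl, rfl⟩, -⟩
    · have hbX := (hX a b hab).mp haX
      exact ⟨hbX, hP a ⟨ha, haX⟩ b ⟨hb, hbX⟩ hab hPa⟩
    · exact absurd haX hy
    · exact absurd hPa hPx

theorem connSets_mono {V : Type*} {G H : SimpleGraph V} (h : G ≤ H) : connSets G ⊆ connSets H :=
  fun _ hS => SimpleGraph.Connected.mono (fun _ _ hab => h hab) hS

theorem mem_of_mem_connSets {V : Type*} {H : SimpleGraph V} {x y : V} {S : Set V}
    (hS : S ∈ connSets H) (hx : x ∈ S) (hy : y ∈ S) : H.Reachable x y := by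
  refine (connected_induce_iff.mp hS).2 (H.Reachable x) ?_ x hx y hy (SimpleGraph.Reachable.refl x)
  exact fun a _ b _ hab hr => hr.trans hab.reachable

theorem mem_connSets_of_sup_edge {V : Type*} {H : SimpleGraph V} {x y : V} {S : Set V}
    (hS : S ∈ connSets (H ⊔ SimpleGraph.edge y x)) (h : x ∉ S ∨ y ∉ S) : S ∈ connSets H := by
  obtain ⟨hne, hS⟩ := connected_induce_iff.mp hS
  refine connected_induce_iff.mpr ⟨hne, fun P hP => hS P ?_⟩
  intro a ha b hb hab
  simp only [SimpleGraph.sup_adj, SimpleGraph.edge_adj] at hab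
  rcases hab with hab | ⟨⟨rfl, rfl⟩ | ⟨rfl, rfl⟩, -⟩
  · exact hP a ha b hb hab
  · tauto
  · tauto

/-- Adding an edge between two components multiplies the numbers of connected sets at its ends. -/
theorem ncard_connSets_sup_edge {V : Type*} [Finite V] {H : SimpleGraph V} {x y : V}
    (hxy : ¬ H.Reachable x y) :
    (connSets (H ⊔ SimpleGraph.edge y x)).ncard
      = (connSets H).ncard + numConnAt H y * numConnAt H x := by
  classical
  set X : Set V := {w | H.Reachable x w} with hXdef
  have hX : ∀ a b, H.Adj a b → (a ∈ X ↔ b ∈ X) := fun a b hab =>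
    ⟨fun h => SimpleGraph.Reachable.trans h hab.reachable,
      fun h => SimpleGraph.Reachable.trans h hab.symm.reachable⟩
  have hxX : x ∈ X := SimpleGraph.Reachable.refl x
  have hyX : y ∉ X := hxy
  set A : Set (Set V) := {S | S ∈ connSets H ∧ y ∈ S} with hA
  set B : Set (Set V) := {S | S ∈ connSets H ∧ x ∈ S} with hB
  have hAX : ∀ S ∈ A, ∀ w ∈ S, w ∉ X := fun S hS w hw hwX =>
    hxy (SimpleGraph.Reachable.trans hwX (mem_of_mem_connSets hS.1 hw hS.2))
  have hBX : ∀ S ∈ B, S ⊆ X := fun S hS w hw => mem_of_mem_connSets hS.1 hS.2 hw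
  have hadj : (H ⊔ SimpleGraph.edge y x).Adj y x := by
    have : y ≠ x := fun h => hyX (h ▸ hxX)
    simp [SimpleGraph.edge_adj, this]
  -- A connected set missing an end of the new edge is connected in `H`; one containing both ends is
  -- a connected set at `y` outside `X` together with one at `x` inside `X`.
  have hdecomp : connSets (H ⊔ SimpleGraph.edge y x)
      = connSets H ∪ (fun p : Set V × Set V => p.1 ∪ p.2) '' (A ×ˢ B) := by
    ext S
    constructor
    · intro hS
      by_cases h : x ∈ S ∧ y ∈ S
      · right
        refine ⟨(S ∩ Xᶜ, S ∩ X), ⟨⟨?_, h.2, hyX⟩, ⟨inter_mem_connSets hX hxX hyX hS h.1, h.1, hxX⟩⟩, ?_⟩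
        · refine inter_mem_connSets (x := y) (y := x) (fun a b hab => not_congr (hX a b hab)) hyX
            (by simpa using hxX) ?_ h.2
          rwa [SimpleGraph.edge_comm]
        · simp only
          rw [← Set.inter_union_distrib_left]
          simp
      · exact Or.inl (mem_connSets_of_sup_edge hS (by tauto))
    · rintro (hS | ⟨⟨S₁, S₂⟩, ⟨h₁, h₂⟩, rfl⟩)
      · exact connSets_mono le_sup_left hS
      · obtain ⟨hne₁, hc₁⟩ := connected_induce_iff.mp h₁.1
        obtain ⟨hne₂, hc₂⟩ := connected_induce_iff.mp h₂.1
        refine connected_induce_iff.mpr ⟨hne₁.inl, fun P hP => ?_⟩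
        have hyS : y ∈ S₁ ∪ S₂ := Or.inl h₁.2
        have hxS : x ∈ S₁ ∪ S₂ := Or.inr h₂.2
        have e₁ := hP y hyS x hxS hadj
        have e₂ := hP x hxS y hyS hadj.symm
        have hc₁ := hc₁ P (fun a ha b hb hab => hP a (Or.inl ha) b (Or.inl hb) (Or.inl hab))
        have hc₂ := hc₂ P (fun a ha b hb hab => hP a (Or.inr ha) b (Or.inr hb) (Or.inl hab))
        rintro u (hu | hu) v (hv | hv) hPu
        · exact hc₁ u hu v hv hPu
        · exact hc₂ x h₂.2 v hv (e₁ (hc₁ u hu y h₁.2 hPu))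
        · exact hc₁ y h₁.2 v hv (e₂ (hc₂ u hu x h₂.2 hPu))
        · exact hc₂ u hu v hv hPu
  rw [hdecomp, Set.ncard_union_eq, Set.InjOn.ncard_image, Set.ncard_prod]
  · rfl
  · rintro ⟨S₁, S₂⟩ ⟨h₁, h₂⟩ ⟨T₁, T₂⟩ ⟨g₁, g₂⟩ h
    simp only at h h₁ h₂ g₁ g₂
    have hw : ∀ w, (w ∈ S₁ ∨ w ∈ S₂) ↔ (w ∈ T₁ ∨ w ∈ T₂) := fun w => by
      simpa using Set.ext_iff.mp h w
    refine Prod.ext ?_ ?_ <;> ext w <;>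
      · have := hw w
        have a₁ := hAX S₁ h₁ w
        have a₂ := hAX T₁ g₁ w
        have b₁ := @hBX S₂ h₂ w
        have b₂ := @hBX T₂ g₂ w
        simp only
        tauto
  · rw [Set.disjoint_left]
    rintro _ hS ⟨⟨S₁, S₂⟩, ⟨h₁, h₂⟩, rfl⟩
    exact hxy (mem_of_mem_connSets hS (Or.inr h₂.2) (Or.inl h₁.2))

/-! ### Moving a branch between two branching vertices. -/

/-- At a vertex of degree at least two of a tree there is a branch away from any other vertex. -/
theorem exists_branch_away {V : Type*} [Finite V] {T : SimpleGraph V} (hT : T.IsTree) {v : V} (u : V)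
    (hv : 2 ≤ (T.neighborSet v).ncard) :
    ∃ x, T.Adj v x ∧ (T.deleteEdges {s(v, x)}).Reachable v u := by
  obtain ⟨p, hp⟩ := hT.connected.exists_isPath v u
  obtain ⟨x, hx, hne⟩ := Set.exists_ne_of_one_lt_ncard hv p.snd
  refine ⟨x, hx, SimpleGraph.reachable_deleteEdges_iff_exists_walk.mpr ⟨p, fun hmem => hne ?_⟩⟩
  exact hT.isAcyclic.eq_snd_of_adj_start hp hx (p.snd_mem_support_of_mem_edges hmem)

/-- Moving a branch of a tree from `v` to `u`. -/
theorem exists_moved_branch {V : Type*} [Finite V] {T : SimpleGraph V} (hT : T.IsTree) {u v : V}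
    (huv : u ≠ v) (hu : 3 ≤ (T.neighborSet u).ncard) (hv : 3 ≤ (T.neighborSet v).ncard)
    (hN : {S | S ∈ connSets T ∧ v ∈ S ∧ u ∉ S}.ncard ≤ {S | S ∈ connSets T ∧ u ∈ S ∧ v ∉ S}.ncard) :
    ∃ T' : SimpleGraph V, T'.IsTree ∧ numLeaves T' = numLeaves T ∧
      numSubtrees T < numSubtrees T' := by
  classical
  obtain ⟨x, hvx, hvu⟩ := exists_branch_away (v := v) hT u (by omega)
  set H := T.deleteEdges {s(v, x)} with hH
  have hxv : ¬ H.Reachable x v := fun h =>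
    SimpleGraph.isBridge_iff.mp
      (SimpleGraph.isAcyclic_iff_forall_adj_isBridge.mp hT.isAcyclic hvx) h.symm
  have hxu : ¬ H.Reachable x u := fun h => hxv (h.trans hvu.symm)
  have hux : u ≠ x := fun h => hxu (h ▸ SimpleGraph.Reachable.refl _)
  have hvx' : v ≠ x := hvx.ne
  have hHT : H ≤ T := SimpleGraph.deleteEdges_le _
  have hHadj : ∀ a b, H.Adj a b ↔ T.Adj a b ∧ s(a, b) ≠ s(v, x) := by
    intro a b; simp [hH, SimpleGraph.deleteEdges_adj]
  have hTH : T = H ⊔ SimpleGraph.edge v x := by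
    ext a b
    simp only [SimpleGraph.sup_adj, SimpleGraph.edge_adj, hHadj, ne_eq, Sym2.eq_iff]
    constructor
    · intro hab
      have := hab.ne
      tauto
    · rintro (h | ⟨⟨rfl, rfl⟩ | ⟨rfl, rfl⟩, -⟩)
      exacts [h.1, hvx, hvx.symm]
  have hHac : H.IsAcyclic := hT.isAcyclic.anti hHT
  set T' := H ⊔ SimpleGraph.edge u x with hT'
  have hT'adj : ∀ a b, T'.Adj a b ↔ H.Adj a b ∨ (a = u ∧ b = x) ∨ (a = x ∧ b = u) := by
    intro a b
    simp only [hT', SimpleGraph.sup_adj, SimpleGraph.edge_adj]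
    constructor
    · tauto
    · rintro (h | ⟨rfl, rfl⟩ | ⟨rfl, rfl⟩)
      · exact Or.inl h
      · exact Or.inr ⟨Or.inl ⟨rfl, rfl⟩, hux⟩
      · exact Or.inr ⟨Or.inr ⟨rfl, rfl⟩, hux.symm⟩
  have hac' : T'.IsAcyclic :=
    SimpleGraph.IsAcyclic.sup_edge_of_not_reachable (fun h => hxu h.symm) hHac
  -- The removed edge from `v` to `x` is replaced by a detour through `u`.
  have hreach : ∀ a b, T.Adj a b → T'.Reachable a b := by
    have hvx'' : T'.Reachable v x :=
      (hvu.mono le_sup_left).trans ((hT'adj u x).mpr (by tauto)).reachable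
    intro a b hab
    by_cases h : H.Adj a b
    · exact (h.reachable).mono le_sup_left
    · have := (hHadj a b).not.mp h
      simp only [hab, true_and, ne_eq, not_not, Sym2.eq_iff] at this
      rcases this with ⟨rfl, rfl⟩ | ⟨rfl, rfl⟩
      exacts [hvx'', hvx''.symm]
  have htree' : T'.IsTree := by
    have := hT.connected.nonempty
    refine ⟨⟨fun a b => ?_⟩, hac'⟩
    obtain ⟨w⟩ := hT.connected.preconnected a b
    induction w with
    | nil => exact SimpleGraph.Reachable.refl _
    | cons h _ ih => exact (hreach _ _ h).trans ih
  refine ⟨T', htree', ?_, ?_⟩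
  -- Only three degrees are affected: `v` keeps at least two neighbours, `u` had at least three
  -- already, and `x` trades `v` for the new neighbour `u`.
  · unfold numLeaves
    congr 1
    ext w
    simp only [Set.mem_ofPred_eq]
    have hnux : ¬ T.Adj u x := fun h => hxu <| by
      refine (SimpleGraph.Adj.reachable ((hHadj u x).mpr ⟨h, ?_⟩)).symm
      simp [huv, hux]
    by_cases hwv : w = v
    · subst hwv
      have : T'.neighborSet w = T.neighborSet w \ {x} := by
        ext b
        simp only [SimpleGraph.mem_neighborSet, hT'adj, hHadj, Set.mem_sdiff, Set.mem_singleton_iff,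
          ne_eq, Sym2.eq_iff]
        constructor
        · rintro (h | ⟨rfl, rfl⟩ | ⟨rfl, rfl⟩)
          · exact ⟨h.1, fun hb => by simp [hb] at h⟩
          · exact absurd rfl huv
          · exact absurd rfl hvx'
        · rintro ⟨h, hb⟩
          exact Or.inl ⟨h, by tauto⟩
      have hx : x ∈ T.neighborSet w := hvx
      rw [this, Set.ncard_sdiff_singleton_of_mem hx]
      omega
    by_cases hwu : w = u
    · subst hwu
      have : T.neighborSet w ⊆ T'.neighborSet w := by
        intro b hb
        simp only [SimpleGraph.mem_neighborSet, hT'adj, hHadj] at hb ⊢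
        refine Or.inl ⟨hb, ?_⟩
        simp [huv, hux]
      have := Set.ncard_le_ncard this
      omega
    by_cases hwx : w = x
    · subst hwx
      have h1 : T'.neighborSet w = insert u (T.neighborSet w \ {v}) := by
        ext b
        simp only [SimpleGraph.mem_neighborSet, hT'adj, hHadj, Set.mem_insert_iff, Set.mem_sdiff,
          Set.mem_singleton_iff, ne_eq, Sym2.eq_iff]
        tauto
      have hv : v ∈ T.neighborSet w := hvx.symm
      have hu : u ∉ T.neighborSet w \ {v} := fun h => hnux h.1.symm
      have := Set.ncard_sdiff_singleton_add_one hv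
      rw [h1, Set.ncard_insert_of_notMem hu, this]
    · have : T'.neighborSet w = T.neighborSet w := by
        ext b
        simp only [SimpleGraph.mem_neighborSet, hT'adj, hHadj, ne_eq, Sym2.eq_iff]
        tauto
      rw [this]
  -- Sets through both `u` and `v` cancel. Cutting the edge destroys no set that avoids `v`, but it
  -- destroys `{v, x}`, which makes the inequality strict.
  · have hcard : numConnAt H v < numConnAt H u := by
      have split : ∀ a b : V, numConnAt H a = {S | S ∈ connSets H ∧ a ∈ S ∧ b ∈ S}.ncard
          + {S | S ∈ connSets H ∧ a ∈ S ∧ b ∉ S}.ncard := by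
        intro a b
        rw [numConnAt, ← Set.ncard_union_eq]
        · congr 1
          ext S
          simp only [Set.mem_ofPred_eq, Set.mem_union]
          tauto
        · rw [Set.disjoint_left]
          intro S h h'
          exact h'.2.2 h.2.2
      have h1 : {S | S ∈ connSets H ∧ v ∈ S ∧ u ∉ S}.ncard
          < {S | S ∈ connSets T ∧ v ∈ S ∧ u ∉ S}.ncard := by
        refine Set.ncard_lt_ncard ⟨fun S hS => ⟨connSets_mono hHT hS.1, hS.2⟩, fun h => ?_⟩
        have hmem : ({v, x} : Set V) ∈ connSets T :=
          SimpleGraph.induce_pair_connected_of_adj hvx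
        have := h (show ({v, x} : Set V) ∈ _ from ⟨hmem, by simp, by simp [huv, hux]⟩)
        exact hxv (mem_of_mem_connSets this.1 (by simp) (by simp))
      have h2 : {S | S ∈ connSets T ∧ u ∈ S ∧ v ∉ S}.ncard
          ≤ {S | S ∈ connSets H ∧ u ∈ S ∧ v ∉ S}.ncard := by
        refine Set.ncard_le_ncard fun S hS => ⟨?_, hS.2⟩
        have := hS.1
        rw [hTH] at this
        exact mem_connSets_of_sup_edge this (Or.inr hS.2.2)
      have h3 : {S | S ∈ connSets H ∧ v ∈ S ∧ u ∈ S} = {S | S ∈ connSets H ∧ u ∈ S ∧ v ∈ S} := by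
        ext S
        simp only [Set.mem_ofPred_eq]
        tauto
      rw [split v u, split u v, h3]
      omega
    have hpos : 0 < numConnAt H x := by
      refine (Set.ncard_pos).mpr ⟨{x}, ?_, rfl⟩
      exact connected_induce_iff.mpr ⟨⟨x, rfl⟩, by rintro P - u rfl v rfl; exact id⟩
    rw [numSubtrees_eq_ncard_connSets hT.isAcyclic, numSubtrees_eq_ncard_connSets hac',
      ncard_connSets_sup_edge hxu]
    conv_lhs => rw [hTH, ncard_connSets_sup_edge hxv]
    have := Nat.mul_lt_mul_of_pos_right hcard hpos
    omega

/-- A tree with two vertices of degree at least three does not have the largest number of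
subtrees. -/
theorem exists_more_subtrees {V : Type*} [Finite V] {T : SimpleGraph V} (hT : T.IsTree) {u v : V}
    (huv : u ≠ v) (hu : 3 ≤ (T.neighborSet u).ncard) (hv : 3 ≤ (T.neighborSet v).ncard) :
    ∃ T' : SimpleGraph V, T'.IsTree ∧ numLeaves T' = numLeaves T ∧
      numSubtrees T < numSubtrees T' := by
  rcases le_total {S | S ∈ connSets T ∧ v ∈ S ∧ u ∉ S}.ncard
    {S | S ∈ connSets T ∧ u ∈ S ∧ v ∉ S}.ncard with h | h
  · exact exists_moved_branch hT huv hu hv h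
  · exact exists_moved_branch hT huv.symm hv hu h

/-! ### Degrees and the number of leaves. -/

theorem sum_ncard_neighborSet {V : Type*} [Fintype V] {T : SimpleGraph V} (hT : T.IsTree) :
    ∑ v, ((T.neighborSet v).ncard : ℤ) = 2 * (Nat.card V : ℤ) - 2 := by
  classical
  have h1 := T.sum_degrees_eq_twice_card_edges
  have h2 := hT.card_edgeFinset
  have h3 : ∀ v, (T.neighborSet v).ncard = T.degree v := by
    intro v
    rw [← SimpleGraph.card_neighborSet_eq_degree, Set.ncard_eq_toFinset_card', Set.toFinset_card]
  simp only [h3, Nat.card_eq_fintype_card]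
  have h1' : ∑ v, (T.degree v : ℤ) = 2 * (T.edgeFinset.card : ℤ) := by exact_mod_cast h1
  rw [h1', ← h2]
  push_cast
  ring

theorem one_le_ncard_neighborSet {V : Type*} [Finite V] {T : SimpleGraph V} (hT : T.IsTree)
    (hV : 2 ≤ Nat.card V) (v : V) : 1 ≤ (T.neighborSet v).ncard := by
  have : Nontrivial V := Finite.one_lt_card_iff_nontrivial.mp (by omega)
  obtain ⟨w, hw⟩ := hT.connected.preconnected.exists_adj_of_nontrivial v
  exact (Set.ncard_pos).mpr ⟨w, hw⟩

theorem numLeaves_eq_sum {V : Type*} [Fintype V] (T : SimpleGraph V) :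
    (numLeaves T : ℤ) = ∑ v, if (T.neighborSet v).ncard = 1 then 1 else 0 := by
  classical
  rw [numLeaves, Set.ncard_eq_toFinset_card', Finset.sum_boole]
  congr 2
  ext v
  simp

/-- Since the degrees sum to 2n - 2, the number of leaves minus 2 is the sum of deg v - 2 + [v is a
leaf]. All these terms are nonnegative, so the term of `r` is at most the sum. -/
theorem le_numLeaves {V : Type*} [Finite V] {T : SimpleGraph V} (hT : T.IsTree)
    (hV : 2 ≤ Nat.card V) {r : V} (hr : 2 ≤ (T.neighborSet r).ncard) :
    (T.neighborSet r).ncard ≤ numLeaves T := by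
  classical
  have := Fintype.ofFinite V
  have h1 := sum_ncard_neighborSet hT
  have h2 := numLeaves_eq_sum T
  have h3 : ∑ v, (((T.neighborSet v).ncard : ℤ) - 2
      + if (T.neighborSet v).ncard = 1 then 1 else 0) = numLeaves T - 2 := by
    rw [Finset.sum_add_distrib, Finset.sum_sub_distrib, h1, ← h2]
    simp only [Finset.sum_const, Finset.card_univ, Nat.card_eq_fintype_card, nsmul_eq_mul]
    ring
  have h4 := Finset.single_le_sum (f := fun v => ((T.neighborSet v).ncard : ℤ) - 2
      + if (T.neighborSet v).ncard = 1 then 1 else 0) (s := Finset.univ) (fun v _ => by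
        have := one_le_ncard_neighborSet hT hV v
        split_ifs <;> omega) (Finset.mem_univ r)
  rw [h3] at h4
  split_ifs at h4 <;> omega

/-- In the same sum every term except that of `r` vanishes. The correction accounts for `r` being a
leaf itself. -/
theorem numLeaves_eq {V : Type*} [Finite V] {T : SimpleGraph V} (hT : T.IsTree)
    (hV : 2 ≤ Nat.card V) {r : V} (h : ∀ v, v ≠ r → (T.neighborSet v).ncard ≤ 2) :
    numLeaves T = (T.neighborSet r).ncard + if (T.neighborSet r).ncard = 1 then 1 else 0 := by
  classical
  have := Fintype.ofFinite V
  have h1 := sum_ncard_neighborSet hT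
  have h2 := numLeaves_eq_sum T
  have h3 : ∑ v, (((T.neighborSet v).ncard : ℤ) - 2
      + if (T.neighborSet v).ncard = 1 then 1 else 0) = numLeaves T - 2 := by
    rw [Finset.sum_add_distrib, Finset.sum_sub_distrib, h1, ← h2]
    simp only [Finset.sum_const, Finset.card_univ, Nat.card_eq_fintype_card, nsmul_eq_mul]
    ring
  rw [Finset.sum_eq_single r] at h3
  · split_ifs at h3 ⊢ <;> omega
  · intro v _ hvr
    have := one_le_ncard_neighborSet hT hV v
    have := h v hvr
    split_ifs <;> omega
  · simp

/-! ### Adjacency, degrees and acyclicity of glued paths. -/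

section GluedPaths

variable {s : ℕ} {len : Fin s → ℕ}

theorem gluedPaths_adj_iff {u v : GluedPathsVertex len} :
    (gluedPaths len).Adj u v ↔ ∃ (i : Fin s) (k : Fin (len i)),
      (u = gluedPathsMap len i k.castSucc ∧ v = gluedPathsMap len i k.succ) ∨
      (v = gluedPathsMap len i k.castSucc ∧ u = gluedPathsMap len i k.succ) := by
  constructor
  · rintro ⟨i, a, b, hab, rfl, rfl⟩
    rw [SimpleGraph.pathGraph_adj] at hab
    rcases hab with h | h
    · refine ⟨i, ⟨a, by omega⟩, Or.inl ⟨rfl, ?_⟩⟩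
      congr 1
      exact Fin.ext h.symm
    · refine ⟨i, ⟨b, by omega⟩, Or.inr ⟨rfl, ?_⟩⟩
      congr 1
      exact Fin.ext h.symm
  · rintro ⟨i, k, ⟨rfl, rfl⟩ | ⟨rfl, rfl⟩⟩
    · exact ⟨i, _, _, SimpleGraph.pathGraph_adj.mpr (Or.inl (by simp)), rfl, rfl⟩
    · exact ⟨i, _, _, SimpleGraph.pathGraph_adj.mpr (Or.inr (by simp)), rfl, rfl⟩

theorem gluedPaths_adj_none {v : GluedPathsVertex len} :
    (gluedPaths len).Adj none v ↔ ∃ (i : Fin s) (h : 0 < len i), v = some ⟨i, ⟨0, h⟩⟩ := by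
  rw [gluedPaths_adj_iff]
  constructor
  · rintro ⟨i, k, ⟨h, rfl⟩ | ⟨-, h⟩⟩
    · refine ⟨i, k.pos, ?_⟩
      have : k.castSucc = 0 := gluedPathsMap_injective len i (h.symm.trans rfl)
      have hk : (k : ℕ) = 0 := by simpa using congrArg Fin.val this
      have : k = ⟨0, by omega⟩ := Fin.ext hk
      rw [this]
      rfl
    · exact absurd h (by simp [gluedPathsMap])
  · rintro ⟨i, h, rfl⟩
    exact ⟨i, ⟨0, h⟩, Or.inl ⟨rfl, rfl⟩⟩

theorem gluedPaths_adj_some {i j : Fin s} {k : Fin (len i)} {l : Fin (len j)} :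
    (gluedPaths len).Adj (some ⟨i, k⟩) (some ⟨j, l⟩) ↔
      i = j ∧ ((k : ℕ) + 1 = l ∨ (l : ℕ) + 1 = k) := by
  constructor
  · rintro ⟨m, a, b, hab, ha, hb⟩
    rw [SimpleGraph.pathGraph_adj] at hab
    revert hab ha hb
    refine Fin.cases ?_ (fun a => ?_) a <;> refine Fin.cases ?_ (fun b => ?_) b
    · simp [gluedPathsMap]
    · simp [gluedPathsMap]
    · simp [gluedPathsMap]
    · intro hab ha hb
      simp only [gluedPathsMap, Fin.cases_succ, Option.some.injEq] at ha hb
      cases ha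
      cases hb
      simpa using hab
  · rintro ⟨rfl, h⟩
    exact ⟨i, k.succ, l.succ, SimpleGraph.pathGraph_adj.mpr (by simpa using h), rfl, rfl⟩

theorem gluedPaths_connected : (gluedPaths len).Connected := by
  have h : ∀ (i : Fin s) (k : ℕ) (hk : k < len i),
      (gluedPaths len).Reachable none (some ⟨i, ⟨k, hk⟩⟩) := by
    intro i k
    induction k with
    | zero => exact fun hk => (gluedPaths_adj_none.mpr ⟨i, hk, rfl⟩).reachable
    | succ k ih =>
      intro hk
      exact (ih (by omega)).trans (gluedPaths_adj_some.mpr ⟨rfl, Or.inl rfl⟩).reachable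
  have h' : ∀ v, (gluedPaths len).Reachable none v := by
    rintro (_ | ⟨i, k⟩)
    · exact SimpleGraph.Reachable.refl _
    · exact h i k k.2
  exact ⟨fun u v => (h' u).symm.trans (h' v)⟩

theorem card_gluedPathsVertex : Nat.card (GluedPathsVertex len) = ∑ i, len i + 1 := by
  simp [GluedPathsVertex]

/-- A connected graph with at most one edge fewer than vertices is a tree, and the edges are covered
by the pairs (leg, position). -/
theorem gluedPaths_isTree : (gluedPaths len).IsTree := by
  refine SimpleGraph.isTree_iff_connected_and_card.mpr ⟨gluedPaths_connected, ?_⟩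
  refine le_antisymm ?_ gluedPaths_connected.card_vert_le_card_edgeSet_add_one
  rw [card_gluedPathsVertex]
  refine Nat.succ_le_succ ?_
  let f : (Σ i : Fin s, Fin (len i)) → Sym2 (GluedPathsVertex len) := fun p =>
    s(gluedPathsMap len p.1 p.2.castSucc, gluedPathsMap len p.1 p.2.succ)
  have hsub : (gluedPaths len).edgeSet ⊆ Set.range f := by
    intro e
    induction e with | _ u v
    intro h
    obtain ⟨i, k, ⟨rfl, rfl⟩ | ⟨rfl, rfl⟩⟩ := gluedPaths_adj_iff.mp h
    · exact ⟨⟨i, k⟩, rfl⟩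
    · exact ⟨⟨i, k⟩, Sym2.eq_swap⟩
  calc Nat.card (gluedPaths len).edgeSet ≤ Nat.card (Set.range f) :=
        Nat.card_mono (Set.toFinite _) hsub
    _ ≤ Nat.card (Σ i : Fin s, Fin (len i)) := Finite.card_range_le f
    _ = ∑ i, len i := by simp

/-- Empty legs must be allowed: for n = s = 2 the spider has legs of lengths 1 and 0. -/
theorem ncard_neighborSet_none :
    ((gluedPaths len).neighborSet none).ncard = {i | 0 < len i}.ncard := by
  symm
  refine Set.ncard_congr (fun i hi => some ⟨i, ⟨0, hi⟩⟩) ?_ ?_ ?_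
  · exact fun i hi => gluedPaths_adj_none.mpr ⟨i, hi, rfl⟩
  · intro i j _ _ h
    simp only [Option.some.injEq, Sigma.mk.injEq] at h
    exact h.1
  · intro v hv
    obtain ⟨i, hi, rfl⟩ := gluedPaths_adj_none.mp hv
    exact ⟨i, hi, rfl⟩

theorem ncard_neighborSet_some (v : GluedPathsVertex len) (hv : v ≠ none) :
    ((gluedPaths len).neighborSet v).ncard ≤ 2 := by
  obtain ⟨⟨i, k⟩, rfl⟩ := Option.ne_none_iff_exists'.mp hv
  -- At the outer end of a leg there is no second neighbour, and `none` is a mere filler in this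
  -- upper bound.
  have : (gluedPaths len).neighborSet (some ⟨i, k⟩) ⊆
      {gluedPathsMap len i k.castSucc,
        if h : (k : ℕ) + 1 < len i then some ⟨i, ⟨k + 1, h⟩⟩ else none} := by
    rintro (_ | ⟨j, l⟩) h
    · left
      obtain ⟨j, hj, h⟩ := gluedPaths_adj_none.mp (SimpleGraph.Adj.symm h)
      simp only [Option.some.injEq] at h
      cases h
      rfl
    · obtain ⟨rfl, h | h⟩ := gluedPaths_adj_some.mp h
      · right
        have : (k : ℕ) + 1 < len i := by omega
        simp [h]
      · left
        have : k.castSucc = l.succ := Fin.ext (by simp [h])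
        rw [this]
        rfl
  exact (Set.ncard_le_ncard this).trans ((Set.ncard_insert_le _ _).trans (by simp))

/-- Legs may be permuted. -/
theorem nonempty_gluedPaths_iso_comp (σ : Fin s ≃ Fin s) :
    Nonempty (gluedPaths (len ∘ σ) ≃g gluedPaths len) := by
  refine ⟨⟨(Equiv.sigmaCongrLeft (β := fun i => Fin (len i)) σ).optionCongr, ?_⟩⟩
  rintro (_ | ⟨i, k⟩) (_ | ⟨j, l⟩)
  · simp
  · simp only [Equiv.optionCongr_apply, Option.map_none, Option.map_some, gluedPaths_adj_none]
    constructor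
    · rintro ⟨i', h, e⟩
      refine ⟨j, by have := l.2; omega, ?_⟩
      simp only [Option.some.injEq, Equiv.sigmaCongrLeft_apply] at e
      cases e
      rfl
    · rintro ⟨i', h, e⟩
      simp only [Option.some.injEq] at e
      cases e
      exact ⟨σ j, h, rfl⟩
  · rw [SimpleGraph.adj_comm, SimpleGraph.adj_comm _ (some _)]
    simp only [Equiv.optionCongr_apply, Option.map_none, Option.map_some, gluedPaths_adj_none]
    constructor
    · rintro ⟨i', h, e⟩
      refine ⟨i, by have := k.2; omega, ?_⟩
      simp only [Option.some.injEq, Equiv.sigmaCongrLeft_apply] at e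
      cases e
      rfl
    · rintro ⟨i', h, e⟩
      simp only [Option.some.injEq] at e
      cases e
      exact ⟨σ i, h, rfl⟩
  · simp only [Equiv.optionCongr_apply, Option.map_some, Equiv.sigmaCongrLeft_apply,
      gluedPaths_adj_some, σ.injective.eq_iff]

/-! ### Connected sets of glued paths and their number. -/

/-- The vertices of the first `c i` edges of each leg. -/
def legPrefixes (len : Fin s → ℕ) (c : ∀ i, Fin (len i + 1)) : Set (GluedPathsVertex len) :=
  {v | ∀ i (k : Fin (len i)), v = some ⟨i, k⟩ → (k : ℕ) < c i}

/-- The vertices of a leg between two given ones. -/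
def legSegment (len : Fin s → ℕ) (p : Σ i : Fin s, Σ b : Fin (len i), Fin ((b : ℕ) + 1)) :
    Set (GluedPathsVertex len) :=
  {v | ∃ k : Fin (len p.1), v = some ⟨p.1, k⟩ ∧ (p.2.2 : ℕ) ≤ k ∧ k ≤ p.2.1}

theorem none_mem_legPrefixes (c : ∀ i, Fin (len i + 1)) : none ∈ legPrefixes len c := by
  intro i k h
  cases h

theorem some_mem_legPrefixes {c : ∀ i, Fin (len i + 1)} {i : Fin s} {k : Fin (len i)} :
    some ⟨i, k⟩ ∈ legPrefixes len c ↔ (k : ℕ) < c i := by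
  constructor
  · exact fun h => h i k rfl
  · intro h j l e
    cases e
    exact h

theorem some_mem_legSegment {i : Fin s} {b k : Fin (len i)} {a : Fin ((b : ℕ) + 1)} :
    some ⟨i, k⟩ ∈ legSegment len ⟨i, b, a⟩ ↔ (a : ℕ) ≤ k ∧ k ≤ b := by
  constructor
  · rintro ⟨l, e, h⟩
    cases e
    exact h
  · exact fun h => ⟨k, rfl, h⟩

theorem legPrefixes_injective : Function.Injective (legPrefixes len) := by
  intro c d h
  funext i
  have key : ∀ k : Fin (len i), (k : ℕ) < c i ↔ (k : ℕ) < d i := fun k => by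
    rw [← some_mem_legPrefixes, ← some_mem_legPrefixes, h]
  have hc := (c i).2
  have hd := (d i).2
  apply Fin.ext
  rcases lt_trichotomy (c i : ℕ) (d i) with hlt | heq | hlt
  · have := (key ⟨c i, by omega⟩).mpr hlt
    simp at this
  · exact heq
  · have := (key ⟨d i, by omega⟩).mp hlt
    simp at this

theorem legSegment_injective : Function.Injective (legSegment len) := by
  rintro ⟨i, b, a⟩ ⟨j, d, c⟩ h
  have hb : some ⟨i, b⟩ ∈ legSegment len ⟨j, d, c⟩ := by
    rw [← h, some_mem_legSegment]
    exact ⟨Nat.lt_succ_iff.mp a.2, le_refl b⟩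
  obtain ⟨k, e, -⟩ := id hb
  obtain rfl : i = j := by
    simp only [Option.some.injEq, Sigma.mk.injEq] at e
    exact e.1
  have key : ∀ k : Fin (len i), ((a : ℕ) ≤ k ∧ k ≤ b) ↔ ((c : ℕ) ≤ k ∧ k ≤ d) := fun k => by
    rw [← some_mem_legSegment, ← some_mem_legSegment, h]
  have ha := a.2
  have hc := c.2
  have hbl := b.2
  have hdl := d.2
  have k1 := (key b).mp ⟨by omega, le_refl b⟩
  have k2 := (key d).mpr ⟨by omega, le_refl d⟩
  obtain rfl : b = d := le_antisymm k1.2 k2.2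
  have k3 := (key ⟨a, by omega⟩).mp ⟨le_refl _, Fin.le_def.mpr (by simp; omega)⟩
  have k4 := (key ⟨c, by omega⟩).mpr ⟨le_refl _, Fin.le_def.mpr (by simp; omega)⟩
  obtain rfl : a = c := Fin.ext (le_antisymm k4.1 k3.1)
  rfl

/-- A connected set which misses a vertex of a leg, but not the rest of the leg, lies in that
rest. -/
theorem beyond_of_notMem {S : Set (GluedPathsVertex len)} (hS : S ∈ connSets (gluedPaths len))
    {i : Fin s} {j k : Fin (len i)} (hj : some ⟨i, j⟩ ∉ S) (hk : some ⟨i, k⟩ ∈ S) (hjk : j < k)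
    {v : GluedPathsVertex len} (hv : v ∈ S) : ∃ l, v = some ⟨i, l⟩ ∧ j < l := by
  refine (connected_induce_iff.mp hS).2 (fun v => ∃ l, v = some ⟨i, l⟩ ∧ j < l) ?_ _ hk v hv
    ⟨k, rfl, hjk⟩
  rintro _ - (_ | ⟨i', l'⟩) hl' hadj ⟨l, rfl, hjl⟩
  · obtain ⟨i', h, e⟩ := gluedPaths_adj_none.mp hadj.symm
    cases e
    exact absurd hjl (by simp [Fin.lt_def])
  · obtain ⟨rfl, h⟩ := gluedPaths_adj_some.mp hadj
    refine ⟨l', rfl, lt_of_le_of_ne ?_ ?_⟩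
    · rw [Fin.le_def]
      rw [Fin.lt_def] at hjl
      omega
    · rintro rfl
      exact hj hl'

theorem same_leg_of_none_notMem {S : Set (GluedPathsVertex len)}
    (hS : S ∈ connSets (gluedPaths len)) (hn : none ∉ S) {i : Fin s} {k : Fin (len i)}
    (hk : some ⟨i, k⟩ ∈ S) {v : GluedPathsVertex len} (hv : v ∈ S) : ∃ l, v = some ⟨i, l⟩ := by
  refine (connected_induce_iff.mp hS).2 (fun v => ∃ l, v = some ⟨i, l⟩) ?_ _ hk v hv ⟨k, rfl⟩
  rintro _ - (_ | ⟨i', l'⟩) hl' hadj ⟨l, rfl⟩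
  · exact absurd hl' hn
  · obtain ⟨rfl, h⟩ := gluedPaths_adj_some.mp hadj
    exact ⟨l', rfl⟩

theorem legPrefixes_mem_connSets (c : ∀ i, Fin (len i + 1)) :
    legPrefixes len c ∈ connSets (gluedPaths len) := by
  refine connected_induce_iff.mpr ⟨⟨none, none_mem_legPrefixes c⟩, fun P hP => ?_⟩
  have key : ∀ v ∈ legPrefixes len c, (P none ↔ P v) := by
    rintro (_ | ⟨i, k, hk⟩) hv
    · exact Iff.rfl
    · induction k with
      | zero =>
        have hadj : (gluedPaths len).Adj none (some ⟨i, ⟨0, hk⟩⟩) :=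
          gluedPaths_adj_none.mpr ⟨i, hk, rfl⟩
        exact ⟨hP _ (none_mem_legPrefixes c) _ hv hadj,
          hP _ hv _ (none_mem_legPrefixes c) hadj.symm⟩
      | succ k ih =>
        have hk' : k < len i := by omega
        have hv' : some ⟨i, ⟨k, hk'⟩⟩ ∈ legPrefixes len c := by
          rw [some_mem_legPrefixes] at hv ⊢
          simp only at hv ⊢
          omega
        have hadj : (gluedPaths len).Adj (some ⟨i, ⟨k, hk'⟩⟩) (some ⟨i, ⟨k + 1, hk⟩⟩) :=
          gluedPaths_adj_some.mpr ⟨rfl, Or.inl rfl⟩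
        exact (ih hk' hv').trans ⟨hP _ hv' _ hv hadj, hP _ hv _ hv' hadj.symm⟩
  exact fun u hu v hv h => (key v hv).mp ((key u hu).mpr h)

theorem legSegment_mem_connSets (p : Σ i : Fin s, Σ b : Fin (len i), Fin ((b : ℕ) + 1)) :
    legSegment len p ∈ connSets (gluedPaths len) := by
  obtain ⟨i, b, a⟩ := p
  have ha := a.2
  have hb := b.2
  have hroot : some ⟨i, b⟩ ∈ legSegment len ⟨i, b, a⟩ :=
    some_mem_legSegment.mpr ⟨by omega, le_refl b⟩
  refine connected_induce_iff.mpr ⟨⟨_, hroot⟩, fun P hP => ?_⟩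
  have hmem : ∀ k (hk : k < len i), (a : ℕ) ≤ k → k ≤ b →
      some ⟨i, ⟨k, hk⟩⟩ ∈ legSegment len ⟨i, b, a⟩ :=
    fun k hk h h' => some_mem_legSegment.mpr ⟨h, h'⟩
  -- Induction on the distance `d` to the outer end `b`, going inwards.
  have key' : ∀ d k, (a : ℕ) ≤ k → ∀ hkd : k + d = b,
      (P (some ⟨i, b⟩) ↔ P (some ⟨i, ⟨k, by omega⟩⟩)) := by
    intro d
    induction d with
    | zero =>
      intro k _ hkd
      have : b = ⟨k, by omega⟩ := Fin.ext hkd.symm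
      rw [← this]
    | succ d ih =>
      intro k hak hkd
      have hadj : (gluedPaths len).Adj (some ⟨i, ⟨k + 1, by omega⟩⟩) (some ⟨i, ⟨k, by omega⟩⟩) :=
        gluedPaths_adj_some.mpr ⟨rfl, Or.inr rfl⟩
      have h1 := hmem k (by omega) hak (by omega)
      have h2 := hmem (k + 1) (by omega) (by omega) (by omega)
      exact (ih (k + 1) (by omega) (by omega)).trans
        ⟨hP _ h2 _ h1 hadj, hP _ h1 _ h2 hadj.symm⟩
  have key : ∀ v ∈ legSegment len ⟨i, b, a⟩, (P (some ⟨i, b⟩) ↔ P v) := by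
    rintro _ ⟨k, rfl, hak, hkb⟩
    have hkb : (k : ℕ) ≤ b := hkb
    exact key' (b - k) k hak (by omega)
  exact fun u hu v hv h => (key v hv).mp ((key u hu).mpr h)

/-- A missed vertex separates the outer rest of its leg from everything else. So a set through the
centre meets each leg in an initial part, and any other set is an interval of a single leg. -/
theorem connSets_gluedPaths :
    connSets (gluedPaths len) = Set.range (legPrefixes len) ∪ Set.range (legSegment len) := by
  classical
  ext S
  constructor
  · intro hS
    by_cases hn : none ∈ S
    · left
      -- The least such `j` is the first position of leg `i` outside `S`, or `len i` if the whole
      -- leg lies in `S`.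
      have hex : ∀ i, ∃ j, ¬ ∃ h : j < len i, some ⟨i, ⟨j, h⟩⟩ ∈ S := fun i => ⟨len i, by simp⟩
      refine ⟨fun i => ⟨Nat.find (hex i), Nat.lt_succ_of_le (Nat.find_min' _ (by simp))⟩, ?_⟩
      ext v
      rcases v with _ | ⟨i, k⟩
      · simp [hn, none_mem_legPrefixes]
      · rw [some_mem_legPrefixes]
        constructor
        · intro h
          have := Nat.find_min (hex i) h
          rw [not_not] at this
          exact this.2
        · intro hk
          by_contra hlt
          have hlt : Nat.find (hex i) ≤ k := not_lt.mp hlt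
          have hspec := Nat.find_spec (hex i)
          have hlen : Nat.find (hex i) < len i := lt_of_le_of_lt hlt k.2
          have hnot : some ⟨i, ⟨Nat.find (hex i), hlen⟩⟩ ∉ S := fun h => hspec ⟨hlen, h⟩
          rcases hlt.lt_or_eq with h | h
          · obtain ⟨l, e, -⟩ := beyond_of_notMem hS hnot hk (Fin.lt_def.mpr h) hn
            cases e
          · have : (⟨Nat.find (hex i), hlen⟩ : Fin (len i)) = k := Fin.ext h
            rw [this] at hnot
            exact hnot hk
    · right
      obtain ⟨_ | ⟨i, k⟩, hk⟩ := (connected_induce_iff.mp hS).1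
      · exact absurd hk hn
      let F : Finset (Fin (len i)) := Finset.univ.filter fun l => some ⟨i, l⟩ ∈ S
      have hF : F.Nonempty := ⟨k, by simpa [F] using hk⟩
      have hmin : some ⟨i, F.min' hF⟩ ∈ S := by
        have := F.min'_mem hF
        simpa [F] using this
      have hmax : some ⟨i, F.max' hF⟩ ∈ S := by
        have := F.max'_mem hF
        simpa [F] using this
      have hle : F.min' hF ≤ F.max' hF := F.min'_le _ (F.max'_mem hF)
      refine ⟨⟨i, F.max' hF, ⟨F.min' hF, Nat.lt_succ_of_le hle⟩⟩, ?_⟩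
      ext v
      constructor
      · rintro ⟨l, rfl, h1, h2⟩
        by_contra hl
        rcases (show l ≤ F.max' hF from h2).lt_or_eq with h | h
        · obtain ⟨m, e, hm⟩ := beyond_of_notMem hS hl hmax h hmin
          simp only [Option.some.injEq, Sigma.mk.injEq, heq_eq_eq, true_and] at e
          rw [← e] at hm
          exact absurd h1 (not_le.mpr hm)
        · exact hl (h ▸ hmax)
      · intro hv
        obtain ⟨l, rfl⟩ := same_leg_of_none_notMem hS hn hk hv
        have hl : l ∈ F := by simpa [F] using hv
        exact ⟨l, rfl, F.min'_le l hl, F.le_max' l hl⟩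
  · rintro (⟨c, rfl⟩ | ⟨p, rfl⟩)
    · exact legPrefixes_mem_connSets c
    · exact legSegment_mem_connSets p

theorem numSubtrees_gluedPaths (len : Fin s → ℕ) :
    numSubtrees (gluedPaths len) = ∏ i, (len i + 1) + ∑ i, (len i + 1).choose 2 := by
  have hsum : ∀ n : ℕ, ∑ b : Fin n, ((b : ℕ) + 1) = (n + 1).choose 2 := by
    intro n
    induction n with
    | zero => rfl
    | succ n ih =>
      rw [Fin.sum_univ_castSucc, Nat.choose_succ_succ' (n + 1) 1]
      simp only [Fin.val_castSucc, Fin.val_last, ih, Nat.choose_one_right]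
      ring
  rw [numSubtrees_eq_ncard_connSets gluedPaths_isTree.isAcyclic, connSets_gluedPaths,
    Set.ncard_union_eq, ← Nat.card_coe_set_eq, ← Nat.card_coe_set_eq,
    Nat.card_range_of_injective legPrefixes_injective,
    Nat.card_range_of_injective legSegment_injective]
  · simp [hsum]
  · rw [Set.disjoint_left]
    rintro _ ⟨c, rfl⟩ ⟨p, hp⟩
    have := none_mem_legPrefixes c
    rw [← hp] at this
    obtain ⟨k, e, -⟩ := this
    cases e

end GluedPaths

/-! ### Balancing the lengths of the legs. -/

/-- The number of subtrees of a graph of glued paths, in terms of the lengths of the legs. -/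
def legCount {s : ℕ} (len : Fin s → ℕ) : ℕ :=
  ∏ i, (len i + 1) + ∑ i, (len i + 1).choose 2

theorem legCount_comp {s : ℕ} (len : Fin s → ℕ) (σ : Fin s ≃ Fin s) :
    legCount (len ∘ σ) = legCount len := by
  simp only [legCount, Function.comp]
  rw [Equiv.prod_comp σ (fun i => len i + 1), Equiv.sum_comp σ (fun i => (len i + 1).choose 2)]

/-- Moving a vertex from a leg to another one which is shorter by at least two. -/
theorem exists_legCount_lt {s : ℕ} (hs : 3 ≤ s) {len : Fin s → ℕ} (hlen : ∀ i, 1 ≤ len i)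
    {i j : Fin s} (hij : len j + 2 ≤ len i) :
    ∃ len' : Fin s → ℕ, (∀ i, 1 ≤ len' i) ∧ ∑ i, len' i = ∑ i, len i ∧
      legCount len < legCount len' := by
  have hne : j ≠ i := by rintro rfl; omega
  let R := (Finset.univ.erase i).erase j
  have hjR : j ∈ Finset.univ.erase i := by simp [hne]
  have hsumR : ∀ g : Fin s → ℕ, ∑ m, g m = g i + (g j + ∑ m ∈ R, g m) := fun g => by
    rw [Finset.add_sum_erase _ _ hjR, Finset.add_sum_erase _ _ (Finset.mem_univ i)]
  have hprodR : ∀ g : Fin s → ℕ, ∏ m, g m = g i * (g j * ∏ m ∈ R, g m) := fun g => by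
    rw [Finset.mul_prod_erase _ _ hjR, Finset.mul_prod_erase _ _ (Finset.mem_univ i)]
  let len' : Fin s → ℕ := fun m => if m = i then len i - 1 else if m = j then len j + 1 else len m
  have hi : len' i = len i - 1 := by simp [len']
  have hj : len' j = len j + 1 := by simp [len', hne]
  have hR : ∀ m ∈ R, len' m = len m := by
    intro m hm
    simp only [R, Finset.mem_erase] at hm
    simp [len', hm.1, hm.2.1]
  obtain ⟨a, ha⟩ : ∃ a, len i = a + 1 := ⟨len i - 1, by omega⟩
  refine ⟨len', ?_, ?_, ?_⟩
  · intro m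
    simp only [len']
    have := hlen m
    split_ifs <;> omega
  · have hsR : ∑ m ∈ R, len' m = ∑ m ∈ R, len m := Finset.sum_congr rfl hR
    rw [hsumR len', hsumR len, hi, hj, hsR]
    omega
  -- This is where s ≥ 3 enters: a third, nonempty leg contributes a factor of at least 2. With two
  -- legs the product would be 1 and nothing would be gained.
  · have hp : 2 ≤ ∏ m ∈ R, (len m + 1) := by
      have hcard : R.card = s - 2 := by
        rw [Finset.card_erase_of_mem hjR, Finset.card_erase_of_mem (Finset.mem_univ i),
          Finset.card_univ, Fintype.card_fin]
        rfl
      obtain ⟨m, hm⟩ : R.Nonempty := Finset.card_pos.mp (by omega)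
      rw [← Finset.mul_prod_erase _ _ hm]
      have h1 : 0 < ∏ x ∈ R.erase m, (len x + 1) := Finset.prod_pos fun x _ => Nat.succ_pos _
      have := hlen m
      nlinarith
    have hs1 : ∑ m ∈ R, (len' m + 1).choose 2 = ∑ m ∈ R, (len m + 1).choose 2 :=
      Finset.sum_congr rfl fun m hm => by rw [hR m hm]
    have hp1 : ∏ m ∈ R, (len' m + 1) = ∏ m ∈ R, (len m + 1) :=
      Finset.prod_congr rfl fun m hm => by rw [hR m hm]
    simp only [legCount]
    rw [hsumR fun m => (len m + 1).choose 2, hsumR fun m => (len' m + 1).choose 2,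
      hprodR fun m => len m + 1, hprodR fun m => len' m + 1, hs1, hp1, hi, hj, ha,
      Nat.choose_succ_succ' (a + 1) 1, Nat.choose_succ_succ' (len j + 1) 1]
    simp only [Nat.add_sub_cancel, Nat.choose_one_right, Nat.reduceAdd]
    generalize ∏ m ∈ R, (len m + 1) = p at hp ⊢
    -- The product gains (e + 1)p and the binomials lose e + 1, a net gain of (e + 1)(p - 1) > 0.
    obtain ⟨e, rfl⟩ : ∃ e, a = len j + 1 + e := ⟨a - (len j + 1), by omega⟩
    nlinarith [Nat.zero_le (e * p), Nat.mul_le_mul_left (e + 1) hp]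

theorem card_filter_lt {s t : ℕ} (ht : t ≤ s) :
    (Finset.univ.filter fun i : Fin s => (i : ℕ) < t).card = t := by
  rw [Fin.card_filter_val_lt]
  exact min_eq_right ht

/-- Balanced legs are those of the spider. -/
theorem exists_eq_spiderLeg_comp {s q t : ℕ} (ht : t < s) {len : Fin s → ℕ}
    (hsum : ∑ i, len i = s * q + t) (hbal : ∀ i j, len i ≤ len j + 1) :
    ∃ σ : Fin s ≃ Fin s, len = spiderLeg s q t ∘ σ := by
  have : Nonempty (Fin s) := ⟨⟨t, ht⟩⟩
  obtain ⟨i₀, hi₀⟩ := Finite.exists_min len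
  set c := (Finset.univ.filter fun i => len i = len i₀ + 1).card with hc
  have hlen : ∀ i, len i = len i₀ + if len i = len i₀ + 1 then 1 else 0 := by
    intro i
    have h1 := hi₀ i
    have h2 := hbal i i₀
    split_ifs <;> omega
  have hsum' : ∑ i, len i = s * len i₀ + c := by
    rw [Finset.sum_congr rfl fun i _ => hlen i, Finset.sum_add_distrib, Finset.sum_boole]
    simp [hc]
  -- The shortest leg `i₀` is not among the `c` longer ones, so `c` is a remainder modulo `s`;
  -- uniqueness of division gives `len i₀ = q` and `c = t`.
  have hcs : c < s := by
    calc c < Finset.univ.card := Finset.card_lt_card (by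
          rw [Finset.filter_ssubset]
          exact ⟨i₀, Finset.mem_univ _, by omega⟩)
      _ = s := by simp
  have h := hsum'.symm.trans hsum
  have hq : len i₀ = q := by
    have h1 : (s * len i₀ + c) / s = len i₀ := by
      rw [Nat.mul_add_div (by omega), Nat.div_eq_of_lt hcs, add_zero]
    have h2 : (s * q + t) / s = q := by
      rw [Nat.mul_add_div (by omega), Nat.div_eq_of_lt ht, add_zero]
    rw [← h1, h, h2]
  rw [hq] at h hlen hc
  have hct : c = t := by omega
  have hcard : Fintype.card {i // len i = q + 1} = Fintype.card {i : Fin s // (i : ℕ) < t} := by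
    rw [Fintype.card_subtype, Fintype.card_subtype, card_filter_lt ht.le, ← hct, hc]
  let e := Fintype.equivOfCardEq hcard
  refine ⟨e.extendSubtype, ?_⟩
  funext i
  simp only [Function.comp, spiderLeg]
  by_cases hi : len i = q + 1
  · rw [if_pos (e.extendSubtype_mem i hi), hi]
  · rw [if_neg (e.extendSubtype_not_mem i hi), hlen i, if_neg hi, add_zero]

theorem sum_spiderLeg {s t : ℕ} (q : ℕ) (ht : t < s) : ∑ i, spiderLeg s q t i = s * q + t := by
  have : ∀ i, spiderLeg s q t i = q + if (i : ℕ) < t then 1 else 0 := by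
    intro i
    simp only [spiderLeg]
    split_ifs <;> rfl
  rw [Finset.sum_congr rfl fun i _ => this i, Finset.sum_add_distrib, Finset.sum_boole,
    card_filter_lt ht.le]
  simp

theorem legCount_spiderLeg {s t : ℕ} (q : ℕ) (ht : t < s) : legCount (spiderLeg s q t) =
    (q + 2) ^ t * (q + 1) ^ (s - t) + t * (q + 2).choose 2 + (s - t) * (q + 1).choose 2 := by
  have h1 := card_filter_lt ht.le
  have h2 : (Finset.univ.filter fun i : Fin s => ¬ (i : ℕ) < t).card = s - t := by
    have := Finset.card_filter_add_card_filter_not (s := Finset.univ)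
      (fun i : Fin s => (i : ℕ) < t)
    rw [h1, Finset.card_univ, Fintype.card_fin] at this
    omega
  have e1 : ∀ i, spiderLeg s q t i + 1 = if (i : ℕ) < t then q + 2 else q + 1 := by
    intro i
    simp only [spiderLeg]
    split_ifs <;> rfl
  have e2 : ∀ i, (spiderLeg s q t i + 1).choose 2
      = if (i : ℕ) < t then (q + 2).choose 2 else (q + 1).choose 2 := by
    intro i
    rw [e1]
    split_ifs <;> rfl
  simp only [legCount, e2]
  simp only [e1, Finset.prod_ite, Finset.sum_ite, Finset.prod_const, Finset.sum_const, h1, h2,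
    smul_eq_mul, add_assoc]

/-- Among at least three legs of given total length, the balanced ones have the largest count. -/
theorem legCount_le {s q t : ℕ} (hs : 3 ≤ s) (ht : t < s) {len : Fin s → ℕ}
    (hlen : ∀ i, 1 ≤ len i) (hsum : ∑ i, len i = s * q + t) :
    legCount len ≤ legCount (spiderLeg s q t) ∧ (legCount len = legCount (spiderLeg s q t) →
      ∃ σ : Fin s ≃ Fin s, len = spiderLeg s q t ∘ σ) := by
  classical
  let F := (Finset.piAntidiag (Finset.univ : Finset (Fin s)) (s * q + t)).filter
    fun f => ∀ i, 1 ≤ f i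
  have hF : ∀ f, f ∈ F ↔ (∑ i, f i = s * q + t) ∧ ∀ i, 1 ≤ f i := by
    intro f
    simp [F, Finset.mem_piAntidiag]
  -- This serves twice: for a maximiser, to find the largest value, and for `len` itself when it
  -- attains that value.
  have hmax : ∀ f ∈ F, (∀ g ∈ F, legCount g ≤ legCount f) →
      ∃ σ : Fin s ≃ Fin s, f = spiderLeg s q t ∘ σ := by
    intro f hf h
    obtain ⟨hf1, hf2⟩ := (hF f).mp hf
    refine exists_eq_spiderLeg_comp ht hf1 fun i j => ?_
    by_contra hij
    obtain ⟨g, hg1, hg2, hg3⟩ := exists_legCount_lt hs hf2 (i := i) (j := j) (by omega)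
    have := h g ((hF g).mpr ⟨hg2.trans hf1, hg1⟩)
    omega
  have hmem := (hF len).mpr ⟨hsum, hlen⟩
  obtain ⟨f, hf, hfmax⟩ := F.exists_max_image legCount ⟨len, hmem⟩
  obtain ⟨σ, hσ⟩ := hmax f hf hfmax
  have hfc : legCount f = legCount (spiderLeg s q t) := by rw [hσ, legCount_comp]
  refine ⟨hfc ▸ hfmax len hmem, fun heq => hmax len hmem fun g hg => ?_⟩
  rw [heq, ← hfc]
  exact hfmax g hg

/-! ### Recognising trees with at most one branching vertex. -/

/-- Two paths from `r` with the same first edge agree as long as both go on, if all the other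
vertices have degree at most two. -/
theorem getVert_eq_of_getVert_one_eq {V : Type*} [Finite V] {G : SimpleGraph V} {r : V}
    (hdeg : ∀ v, v ≠ r → (G.neighborSet v).ncard ≤ 2) {a b : V} {p : G.Walk r a} {q : G.Walk r b}
    (hp : p.IsPath) (hq : q.IsPath) (h : p.getVert 1 = q.getVert 1) (k : ℕ)
    (hkp : k ≤ p.length) (hkq : k ≤ q.length) : p.getVert k = q.getVert k := by
  induction k using Nat.strong_induction_on with
  | _ k ih =>
    match k, ih with
    | 0, _ => simp
    | 1, _ => exact h
    | k + 2, ih =>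
      have h1 := ih (k + 1) (by omega) (by omega) (by omega)
      have h0 := ih k (by omega) (by omega) (by omega)
      have hinj := hp.getVert_injOn
      have hinj' := hq.getVert_injOn
      have hne : p.getVert (k + 1) ≠ r := fun e => by
        have := hinj (show k + 1 ≤ p.length by omega) (show 0 ≤ p.length by omega) (by simpa using e)
        omega
      have a0 : p.getVert k ∈ G.neighborSet (p.getVert (k + 1)) :=
        (p.adj_getVert_succ (show k < p.length by omega)).symm
      have a1 : p.getVert (k + 2) ∈ G.neighborSet (p.getVert (k + 1)) :=
        p.adj_getVert_succ (show k + 1 < p.length by omega)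
      have a2 : q.getVert (k + 2) ∈ G.neighborSet (p.getVert (k + 1)) := by
        rw [h1]
        exact q.adj_getVert_succ (show k + 1 < q.length by omega)
      have n1 : p.getVert k ≠ p.getVert (k + 2) := fun e => by
        have := hinj (show k ≤ p.length by omega) (show k + 2 ≤ p.length by omega) e
        omega
      have n2 : p.getVert k ≠ q.getVert (k + 2) := fun e => by
        rw [h0] at e
        have := hinj' (show k ≤ q.length by omega) (show k + 2 ≤ q.length by omega) e
        omega
      -- If the paths parted here, a vertex other than `r` would have three neighbours.
      by_contra n3
      have hcard : ({p.getVert k, p.getVert (k + 2), q.getVert (k + 2)} : Set V).ncard = 3 :=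
        Set.ncard_eq_three.mpr ⟨_, _, _, n1, n2, n3, rfl⟩
      have hle := Set.ncard_le_ncard (show ({p.getVert k, p.getVert (k + 2), q.getVert (k + 2)} :
        Set V) ⊆ G.neighborSet (p.getVert (k + 1)) by
          rintro x (rfl | rfl | rfl) <;> assumption)
      have := hdeg _ hne
      omega

/-- Paths in a forest are unique, so the two initial parts up to the common vertex coincide. It
makes distinct legs disjoint away from `r`. -/
theorem getVert_one_eq_of_getVert_eq {V : Type*} {G : SimpleGraph V} (hG : G.IsAcyclic) {r : V}
    {a b : V} {p : G.Walk r a} {q : G.Walk r b} (hp : p.IsPath) (hq : q.IsPath) {k l : ℕ}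
    (hk : 1 ≤ k) (hl : 1 ≤ l) (h : p.getVert k = q.getVert l) : p.getVert 1 = q.getVert 1 := by
  have e := congrArg Subtype.val ((hG.subsingleton_path _ _).elim ⟨p.take k, hp.take k⟩
    ⟨(q.take l).copy rfl h.symm, by simpa using hq.take l⟩)
  have e := congrArg (fun w => SimpleGraph.Walk.getVert w 1) e
  simpa [SimpleGraph.Walk.take_getVert, hk, hl] using e

/-- A tree all of whose vertices but `r` have degree at most two consists of paths glued at `r`. -/
theorem nonempty_iso_gluedPaths {V : Type*} [Finite V] {T : SimpleGraph V} (hT : T.IsTree) {r : V}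
    (hdeg : ∀ v, v ≠ r → (T.neighborSet v).ncard ≤ 2) :
    ∃ len : Fin (T.neighborSet r).ncard → ℕ, (∀ i, 1 ≤ len i) ∧
      Nonempty (T ≃g gluedPaths len) := by
  classical
  have := Fintype.ofFinite V
  let e : T.neighborSet r ≃ Fin (T.neighborSet r).ncard :=
    Finite.equivFinOfCardEq (Nat.card_coe_set_eq _)
  -- The leg through a neighbour of `r` is a longest path from `r` that starts with that neighbour.
  have hlong : ∀ i : Fin (T.neighborSet r).ncard, ∃ (w : V) (p : T.Walk r w), p.IsPath ∧
      p.getVert 1 = e.symm i ∧ 1 ≤ p.length ∧ ∀ (w' : V) (p' : T.Walk r w'), p'.IsPath →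
        p'.getVert 1 = e.symm i → 1 ≤ p'.length → p'.length ≤ p.length := by
    intro i
    let L : Set ℕ := {n | ∃ (w : V) (p : T.Walk r w), p.IsPath ∧
      p.getVert 1 = e.symm i ∧ 1 ≤ p.length ∧ p.length = n}
    have hadj : T.Adj r (e.symm i) := (e.symm i).2
    have hne : L.Nonempty := ⟨1, e.symm i, hadj.toWalk, by simp [hadj.ne], by simp, by simp, by simp⟩
    have hbdd : BddAbove L := by
      refine ⟨Fintype.card V, ?_⟩
      rintro _ ⟨w, p, hp, -, -, rfl⟩
      exact hp.length_lt.le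
    obtain ⟨w, p, hp, h1, h2, h3⟩ := Nat.sSup_mem hne hbdd
    refine ⟨w, p, hp, h1, h2, fun w' p' hp' h1' h2' => ?_⟩
    rw [h3]
    exact le_csSup hbdd ⟨w', p', hp', h1', h2', rfl⟩
  choose w p hp hp1 hplen hpmax using hlong
  let len : Fin (T.neighborSet r).ncard → ℕ := fun i => (p i).length
  let f : GluedPathsVertex len → V
    | none => r
    | some ⟨i, k⟩ => (p i).getVert (k + 1)
  have hf : ∀ i a, f (gluedPathsMap len i a) = (p i).getVert a := by
    intro i a
    refine Fin.cases ?_ (fun a => ?_) a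
    · simp [gluedPathsMap, f]
    · simp [gluedPathsMap, f]
  have hr : ∀ i (k : Fin (len i)), (p i).getVert (k + 1) ≠ r := fun i k h => by
    have := (hp i).getVert_injOn (show (k : ℕ) + 1 ≤ (p i).length from k.2)
      (show 0 ≤ (p i).length by omega) (by simpa using h)
    omega
  have hinj : Function.Injective f := by
    rintro (_ | ⟨i, k⟩) (_ | ⟨j, l⟩) h
    · rfl
    · exact absurd h.symm (hr j l)
    · exact absurd h (hr i k)
    · have h' : (p i).getVert (k + 1) = (p j).getVert (l + 1) := h
      have h1 := getVert_one_eq_of_getVert_eq hT.isAcyclic (hp i) (hp j) (by omega) (by omega) h'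
      rw [hp1, hp1] at h1
      obtain rfl : i = j := e.symm.injective (Subtype.ext h1)
      have := (hp i).getVert_injOn (show (k : ℕ) + 1 ≤ (p i).length from k.2)
        (show (l : ℕ) + 1 ≤ (p i).length from l.2) h'
      obtain rfl : k = l := Fin.ext (by omega)
      rfl
  -- The path from `r` to `v` is an initial part of the longest path with the same first edge,
  -- because paths cannot fork away from `r`.
  have hsurj : Function.Surjective f := by
    intro v
    by_cases hv : v = r
    · exact ⟨none, hv.symm⟩
    · obtain ⟨q, hq⟩ := hT.connected.exists_isPath r v
      have hq0 : 0 < q.length := by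
        by_contra h
        exact hv (SimpleGraph.Walk.eq_of_length_eq_zero (Nat.eq_zero_of_not_pos h)).symm
      have hadj : q.getVert 1 ∈ T.neighborSet r := by
        simpa using q.adj_getVert_succ hq0
      have hi : (e.symm (e ⟨_, hadj⟩) : V) = q.getVert 1 := by simp
      have hle := hpmax (e ⟨_, hadj⟩) v q hq hi.symm hq0
      have heq := getVert_eq_of_getVert_one_eq hdeg hq (hp (e ⟨_, hadj⟩))
        (by rw [hp1, hi]) q.length le_rfl hle
      refine ⟨some ⟨e ⟨_, hadj⟩, ⟨q.length - 1, by simp only [len]; omega⟩⟩, ?_⟩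
      simp only [f, Nat.sub_add_cancel hq0]
      rw [← heq, q.getVert_length]
  have hadj : ∀ u v, (gluedPaths len).Adj u v → T.Adj (f u) (f v) := by
    intro u v huv
    obtain ⟨i, k, ⟨rfl, rfl⟩ | ⟨rfl, rfl⟩⟩ := gluedPaths_adj_iff.mp huv
    · rw [hf, hf]
      exact (p i).adj_getVert_succ k.2
    · rw [hf, hf]
      exact ((p i).adj_getVert_succ k.2).symm
  let E := Equiv.ofBijective f ⟨hinj, hsurj⟩
  let φ := SimpleGraph.Iso.map E (gluedPaths len)
  have hle : (gluedPaths len).map E ≤ T := by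
    rintro _ _ ⟨-, u, v, huv, rfl, rfl⟩
    exact hadj u v huv
  -- The image is a connected spanning subgraph of a tree, hence the whole tree; non-edges need no
  -- separate check.
  have hge : T ≤ (gluedPaths len).map E :=
    (SimpleGraph.isTree_iff_minimal_connected.mp hT).2
      (φ.connected_iff.mp gluedPaths_connected) hle
  let ψ : gluedPaths len ≃g T :=
    ⟨E, fun {u v} => ⟨fun h => φ.map_adj_iff.mp (hge h), hadj u v⟩⟩
  exact ⟨len, hplen, ⟨ψ.symm⟩⟩

theorem sum_eq_of_iso_gluedPaths {V : Type*} {T : SimpleGraph V} {s : ℕ} {len : Fin s → ℕ}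
    (e : T ≃g gluedPaths len) : ∑ i, len i + 1 = Nat.card V := by
  rw [← card_gluedPathsVertex]
  exact (Nat.card_congr e.toEquiv).symm

/-- A tree with two leaves is a path. -/
theorem nonempty_iso_of_numLeaves_eq_two {V : Type*} [Finite V] {T : SimpleGraph V} (hT : T.IsTree)
    (hV : 2 ≤ Nat.card V) (hl : numLeaves T = 2) :
    Nonempty (T ≃g gluedPaths fun _ : Fin 1 => Nat.card V - 1) := by
  have hdeg : ∀ v, (T.neighborSet v).ncard ≤ 2 := by
    intro v
    by_contra h
    have := le_numLeaves hT hV (r := v) (by omega)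
    omega
  obtain ⟨r, hr⟩ : {v : V | (T.neighborSet v).ncard = 1}.Nonempty := by
    rw [← Set.ncard_pos]
    change 0 < numLeaves T
    omega
  have hr : (T.neighborSet r).ncard = 1 := hr
  have := nonempty_iso_gluedPaths hT (r := r) fun v _ => hdeg v
  rw [hr] at this
  obtain ⟨len, -, ⟨e⟩⟩ := this
  have hsum := sum_eq_of_iso_gluedPaths e
  have : len = fun _ => Nat.card V - 1 := by
    funext i
    rw [Fin.sum_univ_one] at hsum
    rw [Subsingleton.elim i 0]
    omega
  rw [← this]
  exact ⟨e⟩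

/-- A tree with at least three leaves and a single branching vertex consists of glued paths. -/
theorem exists_iso_gluedPaths {V : Type*} [Finite V] {T : SimpleGraph V} (hT : T.IsTree)
    {s : ℕ} (hs : 3 ≤ s) (hV : 2 ≤ Nat.card V) (hl : numLeaves T = s)
    (hbr : ∀ u v, u ≠ v → 3 ≤ (T.neighborSet u).ncard → ¬ 3 ≤ (T.neighborSet v).ncard) :
    ∃ len : Fin s → ℕ, (∀ i, 1 ≤ len i) ∧ Nonempty (T ≃g gluedPaths len) := by
  obtain ⟨r, hr⟩ : ∃ r, ∀ v, v ≠ r → (T.neighborSet v).ncard ≤ 2 := by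
    by_cases h : ∃ r, 3 ≤ (T.neighborSet r).ncard
    · obtain ⟨r, hr⟩ := h
      refine ⟨r, fun v hv => ?_⟩
      have := hbr r v hv.symm hr
      omega
    · obtain ⟨r⟩ := hT.connected.nonempty
      refine ⟨r, fun v _ => ?_⟩
      have := not_exists.mp h v
      omega
  have hdeg := numLeaves_eq hT hV hr
  obtain rfl : (T.neighborSet r).ncard = s := by
    split_ifs at hdeg <;> omega
  exact nonempty_iso_gluedPaths hT hr

/-! ### The spider is the unique maximiser. -/

theorem spider_isTreeWithLeaves {n s q t : ℕ} (hs : 2 ≤ s) (hsn : s < n ∨ (n = 2 ∧ s = 2))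
    (hn : n = s * q + t + 1) (ht : t < s) : IsTreeWithLeaves (spider s q t) n s := by
  have hcard : Nat.card (GluedPathsVertex (spiderLeg s q t)) = n := by
    rw [card_gluedPathsVertex, sum_spiderLeg q ht, hn]
  refine ⟨gluedPaths_isTree, hcard, ?_⟩
  rw [numLeaves_eq gluedPaths_isTree (by omega) (r := none) ncard_neighborSet_some,
    ncard_neighborSet_none]
  -- If q = 0 then n = t + 1 ≤ s, which leaves only n = s = 2; there the centre is itself the second
  -- leaf.
  rcases Nat.eq_zero_or_pos q with rfl | hq
  · rcases hsn with h | ⟨rfl, rfl⟩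
    · omega
    · obtain rfl : t = 1 := by omega
      have : {i : Fin 2 | 0 < spiderLeg 2 0 1 i} = {0} := by
        ext i
        fin_cases i <;> simp [spiderLeg]
      rw [this]
      simp
  · have : {i : Fin s | 0 < spiderLeg s q t i} = Set.univ := by
      ext i
      simp only [spiderLeg, Set.mem_ofPred_eq, Set.mem_univ, iff_true]
      split_ifs <;> omega
    rw [this, Set.ncard_univ, Nat.card_eq_fintype_card, Fintype.card_fin, if_neg (by omega),
      add_zero]

/-- The spider has the largest number of subtrees, and is the only such tree. -/
theorem numSubtrees_le_spider {n s q t : ℕ} (hs : 2 ≤ s) (hsn : s < n ∨ (n = 2 ∧ s = 2))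
    (hn : n = s * q + t + 1) (ht : t < s) {V : Type*} [Finite V] {T : SimpleGraph V}
    (hT : IsTreeWithLeaves T n s) : numSubtrees T ≤ numSubtrees (spider s q t) ∧
      (numSubtrees T = numSubtrees (spider s q t) → Nonempty (T ≃g spider s q t)) := by
  have hsp := spider_isTreeWithLeaves hs hsn hn ht
  rcases hs.eq_or_lt with hs2 | hs3
  · obtain ⟨e⟩ := nonempty_iso_of_numLeaves_eq_two hT.isTree (by rw [hT.order]; omega)
      (hT.leaves.trans hs2.symm)
    obtain ⟨e'⟩ := nonempty_iso_of_numLeaves_eq_two hsp.isTree (by rw [hsp.order]; omega)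
      (hsp.leaves.trans hs2.symm)
    rw [hT.order] at e
    rw [hsp.order] at e'
    have φ := e.trans e'.symm
    exact ⟨(numSubtrees_congr φ hT.isTree).le, fun _ => ⟨φ⟩⟩
  -- Competitors on the same vertex type suffice, since moving a branch keeps the vertices; there
  -- are finitely many of them.
  · have hmax : ∀ T' : SimpleGraph V, IsTreeWithLeaves T' n s →
        (∀ T'' : SimpleGraph V, IsTreeWithLeaves T'' n s → numSubtrees T'' ≤ numSubtrees T') →
        numSubtrees T' ≤ numSubtrees (spider s q t) ∧
          (numSubtrees T' = numSubtrees (spider s q t) → Nonempty (T' ≃g spider s q t)) := by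
      intro T' hT' h
      obtain ⟨len, hlen, ⟨e⟩⟩ := exists_iso_gluedPaths hT'.isTree hs3 (by rw [hT'.order]; omega)
        hT'.leaves (fun u v huv hu hv => by
          obtain ⟨T'', h1, h2, h3⟩ := exists_more_subtrees hT'.isTree huv hu hv
          have := h T'' ⟨h1, hT'.order, h2.trans hT'.leaves⟩
          omega)
      have hsum := sum_eq_of_iso_gluedPaths e
      rw [hT'.order] at hsum
      obtain ⟨hle, heq⟩ := legCount_le hs3 ht hlen (q := q) (by omega)
      rw [numSubtrees_congr e hT'.isTree, numSubtrees_gluedPaths, numSubtrees_gluedPaths]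
      refine ⟨hle, fun h => ?_⟩
      obtain ⟨σ, rfl⟩ := heq h
      obtain ⟨φ⟩ := nonempty_gluedPaths_iso_comp (len := spiderLeg s q t) σ
      exact ⟨e.trans φ⟩
    obtain ⟨M, hM, hMmax⟩ := Set.exists_max_image {T : SimpleGraph V | IsTreeWithLeaves T n s}
      numSubtrees (Set.toFinite _) ⟨T, hT⟩
    have hle := (hmax M hM hMmax).1
    -- A tree attaining the spider's value is itself a maximiser on `V`, so `hmax` applies to it.
    refine ⟨(hMmax T hT).trans hle, fun h => (hmax T hT fun T'' hT'' => ?_).2 h⟩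
    exact ((hMmax T'' hT'').trans hle).trans h.ge

theorem corollary5p3 (n s q t : ℕ) (hs : 2 ≤ s) (hsn : s < n ∨ (n = 2 ∧ s = 2))
    (hn : n = s * q + t + 1) (ht : t < s) :
    IsTreeWithLeaves (spider s q t) n s ∧
    numSubtrees (spider s q t) =
      (q + 2) ^ t * (q + 1) ^ (s - t) + t * (q + 2).choose 2 + (s - t) * (q + 1).choose 2 ∧
    ∀ {V : Type*} [Finite V] (T : SimpleGraph V), IsTreeWithLeaves T n s →
      (numSubtrees T ≤ numSubtrees (spider s q t) ∧
        (numSubtrees T = numSubtrees (spider s q t) ↔ Nonempty (T ≃g spider s q t))) ∧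
      (numSubtrees T ≤
          (q + 2) ^ t * (q + 1) ^ (s - t) + t * (q + 2).choose 2 + (s - t) * (q + 1).choose 2 ∧
        (numSubtrees T =
            (q + 2) ^ t * (q + 1) ^ (s - t) + t * (q + 2).choose 2 + (s - t) * (q + 1).choose 2 ↔
          Nonempty (T ≃g spider s q t))) := by
  have hformula : numSubtrees (spider s q t) =
      (q + 2) ^ t * (q + 1) ^ (s - t) + t * (q + 2).choose 2 + (s - t) * (q + 1).choose 2 :=
    (numSubtrees_gluedPaths _).trans (legCount_spiderLeg q ht)
  refine ⟨spider_isTreeWithLeaves hs hsn hn ht, hformula, fun {V} _ T hT => ?_⟩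
  obtain ⟨hle, heq⟩ := numSubtrees_le_spider hs hsn hn ht hT
  have h : numSubtrees T ≤ numSubtrees (spider s q t) ∧
      (numSubtrees T = numSubtrees (spider s q t) ↔ Nonempty (T ≃g spider s q t)) :=
    ⟨hle, heq, fun ⟨e⟩ => numSubtrees_congr e hT.isTree⟩
  exact ⟨h, hformula ▸ h⟩
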